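/- For $h \ge 0$ let $T[h]$ be the complete rooted ternary tree of height $h$ ($T[0]$ is a single vertex, and $T[h]$ is obtained from three disjoint copies of $T[h-1]$ by adding a new root adjacent to the roots of the copies), let $P_k$ be the path on $k$ vertices, and let $T[h,k] = T[h] \,\square\, P_k$ be their Cartesian product. For a finite graph $G$ with $n$ vertices and a real number $0<\alpha<1$, a triple $(W,U_0,U_1)$ of pairwise disjoint subsets of $V(G)$ is called a *target triple* (with respect to $\alpha$) if (1) every connected component of $G[U_1]$ has more than $n^{\alpha}$ vertices; (2) every vertex of $U_0$ has a neighbour in $U_1$ and a neighbour in $W$; (3) there is no edge between $U_1$ and $W$; (4) $U_0$ is an independent set; (5) $N(U_0)\cap W$ is an independent set; (6) for distinct $u,v \in U_0$ the sets $N(u)\cap W$ and $N(v)\cap W$ are disjoint. The *rank* of the triple is $|U_0|$. **Lemma.** There are absolute constants $c>0$ and $k_0$ such that for every real $0<\alpha<1$ and every integer $k\ge k_0$ there is $h_0=h_0(\alpha,k)$ such that for every $h\ge h_0$ the following holds. For every permutation $\pi$ of $V(T[h,k])$ (a sequence listing every vertex exactly once) there are a prefix $\pi_0$ of $\pi$ and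 disjoint sets $U_0,U_1\subseteq V(T[h,k])\setminus \pi_0$ such that $(\pi_0,U_0,U_1)$ (with $\pi_0$ regarded as the set of its elements) is a target triple of $T[h,k]$ with respect to $\alpha$, of rank $$|U_0| \;\ge\; c\,(1-\alpha)\,h\,\sqrt{k}.$$ -/

import Mathlib

/-- The nodes of the complete rooted ternary tree of height `h`: words of length at most `h` over
a three-letter alphabet. The empty word is the root and the children of `w` are the words `i :: w`
(available when `w` has length less than `h`). -/
abbrev TernaryNode (h : ℕ) : Type := {w : List (Fin 3) // w.length ≤ h}

instance TernaryNode.instFinite (h : ℕ) : Finite (TernaryNode h) :=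
  List.finite_length_le (Fin 3) h

/-- The complete ternary tree `T[h]` of height `h`, as an undirected graph: two nodes are adjacent
iff one of them is a child of the other. -/
def ternaryTree (h : ℕ) : SimpleGraph (TernaryNode h) where
  Adj u v := (∃ i : Fin 3, u.1 = i :: v.1) ∨ (∃ i : Fin 3, v.1 = i :: u.1)
  symm := ⟨fun _ _ huv => huv.symm⟩
  loopless := ⟨fun u hu => by
    rcases hu with ⟨i, hi⟩ | ⟨i, hi⟩ <;> exact absurd (congrArg List.length hi) (by simp)⟩

/-- The graph `T[h,k]`: the Cartesian product of `T[h]` with the path `P_k` on `k` vertices. -/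
def treePath (h k : ℕ) : SimpleGraph (TernaryNode h × Fin k) :=
  SimpleGraph.boxProd (ternaryTree h) (SimpleGraph.pathGraph k)

/-- `π` is a permutation of the set of all elements of `V`, that is, a sequence in which every
element of `V` occurs exactly once. -/
def IsPermutationOfVertices {V : Type*} (π : List V) : Prop :=
  π.Nodup ∧ ∀ v : V, v ∈ π

/-- `(W, U₀, U₁)` is a target triple of the finite graph `G`, with respect to the exponent `α`;
here `n` is the number of vertices of `G`. The rank of the triple is `U₀.ncard`. -/
structure IsTargetTriple {V : Type*} [Finite V] (G : SimpleGraph V) (α : ℝ)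
    (W U₀ U₁ : Set V) : Prop where
  disjoint_W_U₀ : Disjoint W U₀
  disjoint_W_U₁ : Disjoint W U₁
  disjoint_U₀_U₁ : Disjoint U₀ U₁
  /-- Each connected component of `G[U₁]` has more than `n ^ α` vertices. -/
  large_components : ∀ C : (G.induce U₁).ConnectedComponent,
    (Nat.card V : ℝ) ^ α < (C.supp.ncard : ℝ)
  /-- Each vertex of `U₀` is adjacent to `U₁`. -/
  adj_U₁ : ∀ u ∈ U₀, ∃ v ∈ U₁, G.Adj u v
  /-- Each vertex of `U₀` is adjacent to `W`. -/
  adj_W : ∀ u ∈ U₀, ∃ w ∈ W, G.Adj u w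
  /-- `U₁` is not adjacent to `W`. -/
  not_adj : ∀ v ∈ U₁, ∀ w ∈ W, ¬ G.Adj v w
  /-- `U₀` is an independent set. -/
  indep_U₀ : G.IsIndepSet U₀
  /-- `N(U₀) ∩ W` is an independent set. -/
  indep_neighbors : G.IsIndepSet ((⋃ u ∈ U₀, G.neighborSet u) ∩ W)
  /-- Distinct vertices of `U₀` have no common neighbour in `W`. -/
  disjoint_neighbors : ∀ u ∈ U₀, ∀ v ∈ U₀, u ≠ v →
    Disjoint (G.neighborSet u ∩ W) (G.neighborSet v ∩ W)

/-! For a set W of visited vertices, call a vertex big if it lies in a connected set of more than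
n^α vertices that neither meets W nor is adjacent to it. Every path from a big vertex to W crosses
the frontier (`LinkedIn.exists_mem_bigFrontier`). Degrees are bounded and there are no triangles, so
a constant fraction of the frontier can serve as U₀ (`exists_isTargetTriple`). It remains to find a
prefix with a large frontier.

This goes by induction on the number of levels (`exists_take_bigFrontier`). Each of the three child
subtrees has a time at which it contains K² visited vertices, a large unvisited subtree and many
frontier vertices. The frontier is not monotone in time, but the other two properties are, in
opposite directions. At the median of the three times the middle child has its frontier, the
earliest child still has its visited vertices and the latest still has its unvisited subtree. K
disjoint paths from the earliest to the latest through their parent avoid the middle child, and each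
contributes a new frontier vertex (`le_ncard_bigFrontier_diff`). About (1-α)h levels are available
and K = ⌊k/2⌋, so the rank is in fact linear in k. -/

namespace SimpleGraph

/-! ### Linked sets, the big part and its frontier -/

variable {V : Type*} (G : SimpleGraph V)

/-- `x` and `y` are joined by a path of `G` all of whose edges lie inside `P`. -/
def LinkedIn (P : Set V) : V → V → Prop :=
  Relation.ReflTransGen fun x y => G.Adj x y ∧ x ∈ P ∧ y ∈ P

variable {G}

theorem LinkedIn.symm {P : Set V} {x y : V} (h : G.LinkedIn P x y) : G.LinkedIn P y x := by
  induction h with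
  | refl => exact Relation.ReflTransGen.refl
  | tail _ h ih => exact Relation.ReflTransGen.head ⟨h.1.symm, h.2.2, h.2.1⟩ ih

theorem LinkedIn.trans {P : Set V} {x y z : V} (h : G.LinkedIn P x y) (h' : G.LinkedIn P y z) :
    G.LinkedIn P x z :=
  Relation.ReflTransGen.trans h h'

theorem LinkedIn.mono {P Q : Set V} (hPQ : P ⊆ Q) {x y : V} (h : G.LinkedIn P x y) :
    G.LinkedIn Q x y :=
  Relation.ReflTransGen.mono (fun _ _ h => ⟨h.1, hPQ h.2.1, hPQ h.2.2⟩) _ _ h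

theorem LinkedIn.reachable {P : Set V} {x y : V} (h : G.LinkedIn P x y) (hx : x ∈ P) (hy : y ∈ P) :
    (G.induce P).Reachable ⟨x, hx⟩ ⟨y, hy⟩ := by
  induction h with
  | refl => exact Reachable.refl _
  | tail _ h ih =>
    refine (ih h.2.1).trans (Adj.reachable ?_)
    exact h.1

variable (G)

/-- The union of the connected sets with more than `s` vertices that neither meet `W` nor are
adjacent to `W`. -/
def bigPart (W : Set V) (s : ℝ) : Set V :=
  {v | ∃ S : Set V, v ∈ S ∧ (∀ x ∈ S, G.LinkedIn S v x) ∧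
    (∀ x ∈ S, x ∉ W ∧ ∀ w ∈ W, ¬ G.Adj x w) ∧ s < S.ncard}

/-- The vertices outside `W` adjacent both to `W` and to `G.bigPart W s`. -/
def bigFrontier (W : Set V) (s : ℝ) : Set V :=
  {u | u ∉ W ∧ (∃ w ∈ W, G.Adj u w) ∧ ∃ v ∈ G.bigPart W s, G.Adj u v}

variable {G} {W : Set V} {s : ℝ}

theorem notMem_of_mem_bigPart {v : V} (hv : v ∈ G.bigPart W s) : v ∉ W := by
  obtain ⟨S, hvS, -, hS, -⟩ := hv
  exact (hS v hvS).1

theorem not_adj_of_mem_bigPart {v : V} (hv : v ∈ G.bigPart W s) : ∀ w ∈ W, ¬ G.Adj v w := by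
  obtain ⟨S, hvS, -, hS, -⟩ := hv
  exact (hS v hvS).2

/-- If `y` had no neighbour in `W`, adding it to a connected set witnessing that `x` is big would
make `y` big too. -/
theorem mem_bigFrontier_of_adj [Finite V] {x y : V} (hx : x ∈ G.bigPart W s)
    (hy : y ∉ G.bigPart W s) (hxy : G.Adj x y) : y ∈ G.bigFrontier W s := by
  have hyW : y ∉ W := fun h => not_adj_of_mem_bigPart hx y h hxy
  refine ⟨hyW, ?_, x, hx, hxy.symm⟩
  by_contra! hN
  obtain ⟨S, hxS, hlink, hS, hcard⟩ := hx
  refine hy ⟨insert y S, Set.mem_insert _ _, fun z hz => ?_, fun z hz => ?_, ?_⟩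
  · rcases hz with rfl | hz
    · exact Relation.ReflTransGen.refl
    · exact Relation.ReflTransGen.head ⟨hxy.symm, Set.mem_insert _ _, Set.mem_insert_of_mem _ hxS⟩
        ((hlink z hz).mono (Set.subset_insert _ _))
  · rcases hz with rfl | hz
    · exact ⟨hyW, hN⟩
    · exact hS z hz
  · exact hcard.trans_le (by exact_mod_cast Set.ncard_le_ncard (Set.subset_insert _ _))

/-- A path from the big part to `W` passes through the frontier. -/
theorem LinkedIn.exists_mem_bigFrontier [Finite V] {P : Set V} {a w : V} (h : G.LinkedIn P a w)
    (ha : a ∈ G.bigPart W s) (hw : w ∈ W) : ∃ u ∈ P, u ∈ G.bigFrontier W s := by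
  by_contra! hcon
  have key : w ∈ G.bigPart W s := by
    clear hw
    induction h with
    | refl => exact ha
    | tail _ h ih =>
      by_contra hy
      exact hcon _ h.2.2 (mem_bigFrontier_of_adj ih hy h.1)
  exact notMem_of_mem_bigPart key hw

theorem lt_ncard_supp_of_bigPart [Finite V] (C : (G.induce (G.bigPart W s)).ConnectedComponent) :
    s < (C.supp.ncard : ℝ) := by
  induction C using ConnectedComponent.ind with
  | h v =>
    obtain ⟨v, hv⟩ := v
    obtain ⟨S, hvS, hlink, hS, hcard⟩ := id hv
    have hsub : S ⊆ G.bigPart W s := fun x hx =>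
      ⟨S, hx, fun y hy => (hlink x hx).symm.trans (hlink y hy), hS, hcard⟩
    refine hcard.trans_le ?_
    have hS' : S ⊆ Subtype.val '' ((G.induce (G.bigPart W s)).connectedComponentMk ⟨v, hv⟩).supp := by
      intro x hx
      refine ⟨⟨x, hsub hx⟩, ?_, rfl⟩
      rw [ConnectedComponent.mem_supp_iff, ConnectedComponent.eq]
      exact ((hlink x hx).mono hsub).symm.reachable _ _
    exact_mod_cast (Set.ncard_le_ncard hS').trans (Set.ncard_image_le)

/-! ### Thinning the frontier to a target triple -/

theorem ncard_biUnion_le_mul [Finite V] {N : V → Set V} {D E : ℕ} (hN : ∀ v, (N v).ncard ≤ D)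
    {U : Set V} (hU : U.ncard ≤ E) : (⋃ u ∈ U, N u).ncard ≤ E * D := by
  have hfin := Set.toFinite U
  calc (⋃ u ∈ U, N u).ncard = (⋃ u ∈ hfin.toFinset, N u).ncard := by simp
    _ ≤ ∑ u ∈ hfin.toFinset, (N u).ncard := Finset.set_ncard_biUnion_le _ _
    _ ≤ ∑ u ∈ hfin.toFinset, D := Finset.sum_le_sum fun u _ => hN u
    _ = U.ncard * D := by rw [Finset.sum_const, smul_eq_mul, Set.ncard_eq_toFinset_card U]
    _ ≤ E * D := Nat.mul_le_mul_right _ hU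

/-- In a finite set one finds a subset whose points are separated by a reflexive relation with
bounded classes, smaller only by that bound. -/
theorem exists_separated_subset [Finite V] (N : V → Set V) (hN : ∀ v, v ∈ N v) {D : ℕ}
    (hD : ∀ v, (N v).ncard ≤ D) (hsymm : ∀ u v, u ∈ N v → v ∈ N u) (B : Set V) :
    ∃ U ⊆ B, (∀ u ∈ U, ∀ v ∈ U, u ≠ v → u ∉ N v) ∧ B.ncard ≤ D * U.ncard := by
  obtain ⟨U, hU⟩ := Set.Finite.exists_maximal
    (s := {U : Set V | U ⊆ B ∧ ∀ u ∈ U, ∀ v ∈ U, u ≠ v → u ∉ N v}) (Set.toFinite _)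
    ⟨∅, by simp⟩
  refine ⟨U, hU.prop.1, hU.prop.2, ?_⟩
  -- By maximality of `U`, a point outside all classes of `U` could be added.
  have hcover : B ⊆ ⋃ u ∈ U, N u := by
    intro b hb
    by_contra hcon
    simp only [Set.mem_iUnion, not_exists] at hcon
    have hbU : b ∉ U := fun h => hcon b h (hN b)
    refine hbU (hU.le_of_ge (y := insert b U) ⟨Set.insert_subset hb hU.prop.1, ?_⟩
      (Set.subset_insert _ _) (Set.mem_insert _ _))
    rintro u (rfl | hu) v (rfl | hv) huv
    · exact absurd rfl huv
    · exact hcon v hv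
    · exact fun h => hcon u hu (hsymm _ _ h)
    · exact hU.prop.2 u hu v hv huv
  rw [mul_comm]
  exact (Set.ncard_le_ncard hcover).trans (ncard_biUnion_le_mul hD le_rfl)

variable (G) in
/-- The closed neighbourhood of a vertex. -/
def closedNbhd (v : V) : Set V := insert v (G.neighborSet v)

variable (G) in
/-- The ball of radius three around a vertex. -/
def ballThree (v : V) : Set V := ⋃ x ∈ G.closedNbhd v, ⋃ y ∈ G.closedNbhd x, G.closedNbhd y

theorem mem_closedNbhd_comm {u v : V} : u ∈ G.closedNbhd v ↔ v ∈ G.closedNbhd u := by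
  simp [closedNbhd, G.adj_comm u v, eq_comm]

/-- In a triangle-free graph of bounded degree, a positive proportion of the frontier of `W`
together with the big part completes `W` to a target triple. -/
theorem exists_isTargetTriple [Finite V] {D : ℕ} (hD : ∀ v, (G.closedNbhd v).ncard ≤ D)
    (htri : ∀ x y z, G.Adj x y → G.Adj y z → ¬ G.Adj x z) (α : ℝ) (W : Set V) :
    ∃ U₀ U₁ : Set V, IsTargetTriple G α W U₀ U₁ ∧
      (G.bigFrontier W ((Nat.card V : ℝ) ^ α)).ncard ≤ D * (D * D) * U₀.ncard := by
  set s := (Nat.card V : ℝ) ^ α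
  have hself : ∀ v, v ∈ G.closedNbhd v := fun v => Set.mem_insert _ _
  have hadj : ∀ {u v}, G.Adj u v → u ∈ G.closedNbhd v := fun h => Set.mem_insert_of_mem _ h.symm
  have hball : ∀ {u v}, u ∈ G.ballThree v ↔
      ∃ x ∈ G.closedNbhd v, ∃ y ∈ G.closedNbhd x, u ∈ G.closedNbhd y := by
    simp [ballThree]
  obtain ⟨U, hUB, hsep, hcard⟩ := exists_separated_subset G.ballThree
    (fun v => hball.2 ⟨v, hself v, v, hself v, hself v⟩) (D := D * (D * D))
    (fun v => ncard_biUnion_le_mul (fun x => ncard_biUnion_le_mul hD (hD x)) (hD v))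
    (fun u v h => by
      obtain ⟨x, hx, y, hy, hu⟩ := hball.1 h
      exact hball.2 ⟨y, mem_closedNbhd_comm.1 hu, x, mem_closedNbhd_comm.1 hy,
        mem_closedNbhd_comm.1 hx⟩)
    (G.bigFrontier W s)
  -- Radius three is dictated by condition (5): an edge between neighbours of distinct `u`, `v`
  -- gives a path of length three. If `u = v`, the edge would close a triangle.
  refine ⟨U, G.bigPart W s, ⟨?_, ?_, ?_, lt_ncard_supp_of_bigPart, ?_, ?_, ?_, ?_, ?_, ?_⟩, hcard⟩
  · exact Set.disjoint_right.2 fun u hu => (hUB hu).1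
  · exact Set.disjoint_right.2 fun u hu => notMem_of_mem_bigPart hu
  · refine Set.disjoint_left.2 fun u hu hu' => ?_
    obtain ⟨w, hw, huw⟩ := (hUB hu).2.1
    exact not_adj_of_mem_bigPart hu' w hw huw
  · exact fun u hu => (hUB hu).2.2
  · exact fun u hu => (hUB hu).2.1
  · exact fun v hv => not_adj_of_mem_bigPart hv
  · intro u hu v hv huv h
    exact hsep u hu v hv huv (hball.2 ⟨v, hself v, v, hself v, hadj h⟩)
  · rintro w ⟨hw, -⟩ w' ⟨hw', -⟩ - h
    simp only [Set.mem_iUnion, mem_neighborSet] at hw hw'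
    obtain ⟨u, hu, huw⟩ := hw
    obtain ⟨v, hv, hvw⟩ := hw'
    by_cases huv : u = v
    · subst huv
      exact htri _ _ _ huw h hvw
    · exact hsep u hu v hv huv (hball.2 ⟨w', hadj hvw.symm, w, hadj h, hadj huw⟩)
  · intro u hu v hv huv
    refine Set.disjoint_left.2 fun w hw hw' => ?_
    exact hsep u hu v hv huv (hball.2 ⟨v, hself v, w, hadj hw'.1.symm, hadj hw.1⟩)

end SimpleGraph

/-! ### Geometry of the product of tree and path -/

namespace TernaryPath

open SimpleGraph

variable {h k : ℕ}

theorem treePath_adj {x y : TernaryNode h × Fin k} : (treePath h k).Adj x y ↔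
    ((∃ i : Fin 3, x.1.1 = i :: y.1.1) ∨ (∃ i : Fin 3, y.1.1 = i :: x.1.1)) ∧ x.2 = y.2 ∨
      (x.2.1 + 1 = y.2.1 ∨ y.2.1 + 1 = x.2.1) ∧ x.1 = y.1 := by
  rw [treePath, boxProd_adj, pathGraph_adj]
  rfl

theorem treePath_triangle_free (x y z : TernaryNode h × Fin k) (hxy : (treePath h k).Adj x y)
    (hyz : (treePath h k).Adj y z) : ¬ (treePath h k).Adj x z := by
  -- The graph is bipartite: depth plus row changes parity along every edge.
  have parity : ∀ {u v : TernaryNode h × Fin k}, (treePath h k).Adj u v →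
      (u.1.1.length + u.2.1) % 2 ≠ (v.1.1.length + v.2.1) % 2 := by
    intro u v huv
    rcases treePath_adj.1 huv with ⟨⟨i, hi⟩ | ⟨i, hi⟩, hr⟩ | ⟨hr, hw⟩
    · rw [hi, hr, List.length_cons]; omega
    · rw [hi, hr, List.length_cons]; omega
    · rw [hw]; omega
  intro hxz
  have h₁ := parity hxy
  have h₂ := parity hyz
  have h₃ := parity hxz
  omega

theorem ncard_closedNbhd_le (v : TernaryNode h × Fin k) :
    ((treePath h k).closedNbhd v).ncard ≤ 7 := by
  classical
  let f : TernaryNode h × Fin k → List (Fin 3) × ℕ := fun x => (x.1.1, x.2.1)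
  have hf : Function.Injective f := by
    rintro ⟨⟨a, _⟩, b⟩ ⟨⟨c, _⟩, d⟩ hxy
    simpa [f, Fin.ext_iff] using hxy
  -- At the root `tail`, and in row 0 the truncated subtraction, merely repeat `v`; this is harmless
  -- for an upper bound.
  let T : List (List (Fin 3) × ℕ) := [(v.1.1, v.2.1), (v.1.1.tail, v.2.1), (0 :: v.1.1, v.2.1),
    (1 :: v.1.1, v.2.1), (2 :: v.1.1, v.2.1), (v.1.1, v.2.1 + 1), (v.1.1, v.2.1 - 1)]
  have hsub : f '' (treePath h k).closedNbhd v ⊆ T.toFinset := by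
    rintro _ ⟨x, rfl | hx, rfl⟩
    · simp [f, T]
    · rcases treePath_adj.1 hx with ⟨⟨i, hi⟩ | ⟨i, hi⟩, hr⟩ | ⟨hr | hr, hw⟩
      · simp [f, T, hi, hr]
      · fin_cases i <;> simp_all [f, T]
      · simp [f, T, hr, hw]
      · simp [f, T, ← hr, hw]
  rw [← Set.ncard_image_of_injective _ hf]
  refine (Set.ncard_le_ncard hsub).trans ?_
  rw [Set.ncard_coe_finset]
  exact (List.toFinset_card_le T).trans (by simp [T])

/-- The vertices of `T[h,k]` whose tree coordinate lies in the subtree rooted at `w`. -/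
def below (h k : ℕ) (w : List (Fin 3)) : Set (TernaryNode h × Fin k) := {v | w <:+ v.1.1}

theorem below_subset {w e : List (Fin 3)} (hwe : w <:+ e) : below h k e ⊆ below h k w :=
  fun _ hv => hwe.trans hv

theorem cons_eq_of_suffix {a b : Fin 3} {w x : List (Fin 3)} (ha : a :: w <:+ x)
    (hb : b :: w <:+ x) : a = b := by
  have := (List.suffix_of_suffix_length_le ha hb (by simp)).eq_of_length (by simp)
  simpa using this

theorem pow_mul_le_ncard_below {w : List (Fin 3)} {q : ℕ} (hq : w.length + q ≤ h) :
    3 ^ q * k ≤ (below h k w).ncard := by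
  let f : (Fin q → Fin 3) × Fin k → below h k w := fun p =>
    ⟨(⟨List.ofFn p.1 ++ w, by simp; omega⟩, p.2), List.suffix_append _ _⟩
  have hf : Function.Injective f := by
    rintro ⟨a, b⟩ ⟨c, d⟩ hxy
    simpa [f, Subtype.ext_iff, Prod.ext_iff] using hxy
  have := Nat.card_le_card_of_injective f hf
  rwa [Nat.card_prod, Nat.card_fun, Nat.card_fin, Nat.card_fin, Nat.card_fin,
    Nat.card_coe_set_eq] at this

/-- A set with fewer than `3 ^ q` vertices misses a subtree rooted `q` levels below `w`. -/
theorem exists_below_disjoint {w : List (Fin 3)} {q : ℕ} {W : Set (TernaryNode h × Fin k)}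
    (hW : (W ∩ below h k w).ncard < 3 ^ q) :
    ∃ e, w <:+ e ∧ e.length = w.length + q ∧ ∀ v ∈ W, v ∉ below h k e := by
  by_contra! hcon
  have key : ∀ u : Fin q → Fin 3, ∃ v ∈ W, v ∈ below h k (List.ofFn u ++ w) := fun u =>
    hcon _ (List.suffix_append _ _) (by simp [add_comm])
  choose g hgW hg using key
  let f : (Fin q → Fin 3) → (W ∩ below h k w : Set (TernaryNode h × Fin k)) := fun u =>
    ⟨g u, hgW u, below_subset (List.suffix_append _ _) (hg u)⟩
  have hf : Function.Injective f := by
    intro u u' huu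
    have hgu : g u = g u' := congrArg Subtype.val huu
    have h₁ : List.ofFn u ++ w <:+ (g u).1.1 := hg u
    have h₂ : List.ofFn u' ++ w <:+ (g u).1.1 := hgu ▸ hg u'
    have := (List.suffix_of_suffix_length_le h₁ h₂ (by simp)).eq_of_length (by simp)
    simpa using this
  have := Nat.card_le_card_of_injective f hf
  rw [Nat.card_fun, Nat.card_fin, Nat.card_fin, Nat.card_coe_set_eq] at this
  omega

theorem linkedIn_branch {P : Set (TernaryNode h × Fin k)} {r : Fin k} {w x : TernaryNode h}
    (hwx : w.1 <:+ x.1) (hP : ∀ u : TernaryNode h, w.1 <:+ u.1 → u.1 <:+ x.1 → (u, r) ∈ P) :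
    (treePath h k).LinkedIn P (w, r) (x, r) := by
  obtain ⟨w, hw⟩ := w
  obtain ⟨x, hx⟩ := x
  obtain ⟨l, hl⟩ := hwx
  induction l generalizing x with
  | nil =>
    have : w = x := by simpa using hl
    subst this
    exact Relation.ReflTransGen.refl
  | cons i l ih =>
    have hlx : x = i :: (l ++ w) := by simpa using hl.symm
    subst hlx
    have hlen : (l ++ w).length ≤ h := by simp at hx ⊢; omega
    refine Relation.ReflTransGen.tail (ih (l ++ w) hlen
      (fun u hwu hux => hP u hwu (hux.trans (List.suffix_cons _ _))) rfl) ⟨?_, ?_, ?_⟩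
    · exact treePath_adj.2 (Or.inl ⟨Or.inr ⟨i, rfl⟩, rfl⟩)
    · exact hP ⟨l ++ w, hlen⟩ (List.suffix_append _ _) (List.suffix_cons _ _)
    · exact hP ⟨i :: (l ++ w), hx⟩ ⟨i :: l, rfl⟩ (List.suffix_refl _)

theorem linkedIn_column {P : Set (TernaryNode h × Fin k)} {z : TernaryNode h} (ρ : ℕ → Fin k)
    (i : ℕ) (hρ : ∀ s < i, (pathGraph k).Adj (ρ s) (ρ (s + 1))) (hP : ∀ s ≤ i, (z, ρ s) ∈ P) :
    (treePath h k).LinkedIn P (z, ρ 0) (z, ρ i) := by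
  induction i with
  | zero => exact Relation.ReflTransGen.refl
  | succ i ih =>
    refine Relation.ReflTransGen.tail (ih (fun s hs => hρ s (by omega))
      fun s hs => hP s (by omega)) ⟨?_, hP i (by omega), hP (i + 1) le_rfl⟩
    exact boxProd_adj_right.2 (hρ i (by omega))

theorem linkedIn_below {d : TernaryNode h} {u v : TernaryNode h × Fin k}
    (hu : u ∈ below h k d.1) (hv : v ∈ below h k d.1) :
    (treePath h k).LinkedIn (below h k d.1) u v := by
  have hbranch : ∀ {x : TernaryNode h × Fin k}, x ∈ below h k d.1 →
      (treePath h k).LinkedIn (below h k d.1) (d, x.2) x :=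
    fun {x} hx => linkedIn_branch (x := x.1) hx fun u hu _ => hu
  refine (hbranch hu).symm.trans (LinkedIn.trans ?_ (hbranch hv))
  have := (reachable_iff_reflTransGen _ _).1 (pathGraph_preconnected k u.2 v.2)
  refine Relation.ReflTransGen.lift (fun r => (d, r)) (fun a b hab => ?_) _ _ this
  exact ⟨boxProd_adj_right.2 hab, List.suffix_refl _, List.suffix_refl _⟩

/-- If the subtree at `e` misses `W`, the subtree at a child of `e` belongs to the big part. -/
theorem mem_bigPart_of_below_disjoint {W : Set (TernaryNode h × Fin k)} {s : ℝ}
    {e : List (Fin 3)} {q : ℕ} (heq : e.length + 1 + q ≤ h)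
    (he : ∀ v ∈ W, v ∉ below h k e) (hs : s < ((3 ^ q * k : ℕ) : ℝ)) :
    ∀ v ∈ below h k (0 :: e), v ∈ (treePath h k).bigPart W s := by
  intro v hv
  -- Passing to a child is needed because `e` itself may have its parent in `W`; all neighbours of
  -- the child's subtree lie below `e`.
  refine ⟨below h k (0 :: e), hv, fun x hx => ?_, fun x hx => ⟨fun hxW => ?_, fun w hw hxw => ?_⟩, ?_⟩
  · exact linkedIn_below (d := ⟨0 :: e, by simp; omega⟩) hv hx
  · exact he x hxW (below_subset (List.suffix_cons _ _) hx)
  · refine he w hw ?_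
    have hxe : e <:+ x.1.1 := (List.suffix_cons _ _).trans hx
    rcases treePath_adj.1 hxw with ⟨⟨i, hi⟩ | ⟨i, hi⟩, -⟩ | ⟨-, hr⟩
    · have hx' : 0 :: e <:+ i :: w.1.1 := hi ▸ hx
      rcases List.suffix_cons_iff.1 hx' with h' | h'
      · obtain ⟨-, rfl⟩ := List.cons.inj h'
        exact List.suffix_refl _
      · exact (List.suffix_cons _ _).trans h'
    · show e <:+ w.1.1
      rw [hi]
      exact hxe.trans (List.suffix_cons _ _)
    · show e <:+ w.1.1
      rwa [← hr]
  · refine hs.trans_le ?_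
    exact_mod_cast pow_mul_le_ncard_below (by simp; omega)

/-! ### Vertex counts and the threshold n^α -/

theorem two_mul_card_ternaryNode_lt (h : ℕ) : 2 * Nat.card (TernaryNode h) < 3 ^ (h + 1) := by
  induction h with
  | zero =>
    have : Nat.card (TernaryNode 0) ≤ 1 := by
      rw [Finite.card_le_one_iff_subsingleton]
      refine ⟨fun a b => Subtype.ext ?_⟩
      rw [List.length_eq_zero_iff.1 (Nat.le_zero.1 a.2), List.length_eq_zero_iff.1 (Nat.le_zero.1 b.2)]
    omega
  | succ h ih =>
    let f : TernaryNode (h + 1) → Option (Fin 3 × TernaryNode h) := fun w =>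
      match w with
      | ⟨[], _⟩ => none
      | ⟨i :: w, hw⟩ => some (i, ⟨w, by simpa using hw⟩)
    have hf : Function.Injective f := by
      rintro ⟨_ | ⟨i, w⟩, hw⟩ ⟨_ | ⟨j, v⟩, hv⟩ hwv <;> simp_all [f]
    have := Nat.card_le_card_of_injective f hf
    rw [Finite.card_option, Nat.card_prod, Nat.card_fin] at this
    rw [pow_succ]
    omega

/-- This converts the threshold into a height: a subtree with `q` levels below its root is already
large enough. -/
theorem card_rpow_lt {α : ℝ} (hα : 0 < α) (hα' : α < 1) (hk : 0 < k) {q : ℕ}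
    (hq : α * (h + 1) ≤ q) :
    (Nat.card (TernaryNode h × Fin k) : ℝ) ^ α < ((3 ^ q * k : ℕ) : ℝ) := by
  have hk1 : (1 : ℝ) ≤ k := by exact_mod_cast hk
  have hn : Nat.card (TernaryNode h × Fin k) < 3 ^ (h + 1) * k := by
    rw [Nat.card_prod, Nat.card_fin]
    have := two_mul_card_ternaryNode_lt h
    exact Nat.mul_lt_mul_of_pos_right (by omega) hk
  calc (Nat.card (TernaryNode h × Fin k) : ℝ) ^ α < ((3 ^ (h + 1) * k : ℕ) : ℝ) ^ α :=
        Real.rpow_lt_rpow (by positivity) (by exact_mod_cast hn) hα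
    _ = (3 : ℝ) ^ (α * (h + 1)) * (k : ℝ) ^ α := by
        push_cast
        rw [Real.mul_rpow (by positivity) (by positivity), ← Real.rpow_natCast,
          ← Real.rpow_mul (by norm_num), mul_comm α]
        push_cast
        rfl
    _ ≤ (3 : ℝ) ^ (q : ℝ) * (k : ℝ) ^ (1 : ℝ) := by
        gcongr; norm_num
    _ = ((3 ^ q * k : ℕ) : ℝ) := by
        rw [Real.rpow_natCast, Real.rpow_one]
        push_cast
        rfl

/-! ### Roads from visited vertices to the big part -/

/-- The union of a piece of the column of `x` (along the rows `ρ 0, …, ρ i`) with the tree paths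
from `w` to `x` and from `w` to `d` in the row `ρ i`. -/
def road (w x d : TernaryNode h) (ρ : ℕ → Fin k) (i : ℕ) : Set (TernaryNode h × Fin k) :=
  {v | (v.1 = x ∧ ∃ s ≤ i, v.2 = ρ s) ∨ ((w.1 <:+ v.1.1 ∧ (v.1.1 <:+ x.1 ∨ v.1.1 <:+ d.1)) ∧
    v.2 = ρ i)}

theorem exists_mem_road_bigFrontier {W : Set (TernaryNode h × Fin k)} {s : ℝ}
    {w x d : TernaryNode h} (hwx : w.1 <:+ x.1) (hwd : w.1 <:+ d.1)
    (hd : ∀ r, (d, r) ∈ (treePath h k).bigPart W s) (ρ : ℕ → Fin k) (i : ℕ)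
    (hρ : ∀ s < i, (pathGraph k).Adj (ρ s) (ρ (s + 1))) (hx : (x, ρ 0) ∈ W) :
    ∃ u ∈ road w x d ρ i, u ∈ (treePath h k).bigFrontier W s := by
  refine LinkedIn.exists_mem_bigFrontier (a := (d, ρ i)) (w := (x, ρ 0)) ?_ (hd _) hx
  have h₁ : (treePath h k).LinkedIn (road w x d ρ i) (x, ρ 0) (x, ρ i) :=
    linkedIn_column ρ i hρ fun s hs => Or.inl ⟨rfl, s, hs, rfl⟩
  have h₂ : (treePath h k).LinkedIn (road w x d ρ i) (w, ρ i) (x, ρ i) :=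
    linkedIn_branch hwx fun u hwu hux => Or.inr ⟨⟨hwu, Or.inl hux⟩, rfl⟩
  have h₃ : (treePath h k).LinkedIn (road w x d ρ i) (w, ρ i) (d, ρ i) :=
    linkedIn_branch hwd fun u hwu hud => Or.inr ⟨⟨hwu, Or.inr hud⟩, rfl⟩
  exact h₃.symm.trans (h₂.trans h₁.symm)

theorem road_subset {w x d : TernaryNode h} {a b c : Fin 3} (hab : a ≠ b) (hcb : c ≠ b)
    (hx : a :: w.1 <:+ x.1) (hd : c :: w.1 <:+ d.1) (ρ : ℕ → Fin k) (i : ℕ) :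
    road w x d ρ i ⊆ below h k w.1 \ below h k (b :: w.1) := by
  rintro v (⟨hv, -⟩ | ⟨⟨hwv, hv⟩, -⟩)
  · refine ⟨?_, fun hb => ?_⟩
    · show w.1 <:+ v.1.1
      rw [hv]
      exact (List.suffix_cons _ _).trans hx
    · have hb' : b :: w.1 <:+ v.1.1 := hb
      rw [hv] at hb'
      exact hab (cons_eq_of_suffix hx hb')
  · refine ⟨hwv, fun hb => ?_⟩
    rcases hv with hv | hv
    · exact hab (cons_eq_of_suffix hx (List.IsSuffix.trans hb hv))
    · exact hcb (cons_eq_of_suffix hd (List.IsSuffix.trans hb hv))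

/-- Roads that start in one row are disjoint if the deeper starting point turns in a further row. -/
theorem road_disjoint {w x y d : TernaryNode h} {a c : Fin 3} (hac : a ≠ c)
    (hy : a :: w.1 <:+ y.1) (hd : c :: w.1 <:+ d.1) (hxy : x ≠ y)
    (hlen : x.1.length ≤ y.1.length) {ρ : ℕ → Fin k} {i j : ℕ} (hρ : ∀ s ≤ i, ρ s ≠ ρ j) :
    Disjoint (road w x d ρ i) (road w y d ρ j) := by
  refine Set.disjoint_left.2 ?_
  have hrow : ∀ v ∈ road w x d ρ i, v.2 ≠ ρ j := by
    rintro v (⟨-, s, hs, hv⟩ | ⟨-, hv⟩) hv'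
    · exact hρ s hs (hv.symm.trans hv')
    · exact hρ i le_rfl (hv.symm.trans hv')
  -- The first road avoids row `ρ j`, so a common vertex lies in the column of `y`. Then `y` is `x`,
  -- or an ancestor of `x` (excluded by depth), or on the branch to `d` (excluded by `a ≠ c`).
  rintro v hv (⟨rfl, -⟩ | ⟨-, hv'⟩)
  · rcases hv with ⟨rfl, -⟩ | ⟨⟨-, hv | hv⟩, -⟩
    · exact hxy rfl
    · exact hxy (Subtype.ext (hv.eq_of_length (le_antisymm hv.length_le hlen)).symm)
    · exact hac (cons_eq_of_suffix (hy.trans hv) hd)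
  · exact hrow v hv hv'

theorem le_ncard_of_injective {V : Type*} [Finite V] {T : Set V} {K : ℕ} (f : Fin K → V)
    (hf : Function.Injective f) (hT : ∀ i, f i ∈ T) : K ≤ T.ncard := by
  have := Nat.card_le_card_of_injective (fun i => (⟨f i, hT i⟩ : T))
    fun i j hij => hf (congrArg Subtype.val hij)
  rwa [Nat.card_fin, Nat.card_coe_set_eq] at this

/-- Many points in distinct rows, or many points in a common row. -/
theorem exists_rows_or_row {α β : Type*} [Finite α] [Finite β] {K : ℕ} (S : Set (α × β))
    (hS : K * K ≤ S.ncard) : K ≤ (Prod.snd '' S).ncard ∨ ∃ r, K ≤ {x | (x, r) ∈ S}.ncard := by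
  by_contra! hcon
  obtain ⟨h₁, h₂⟩ := hcon
  have hcover : S = ⋃ r ∈ (Set.toFinite (Prod.snd '' S)).toFinset,
      (fun x => (x, r)) '' {x | (x, r) ∈ S} := by
    ext ⟨x, r⟩
    simp only [Set.Finite.mem_toFinset, Set.mem_iUnion, Set.mem_image, Set.mem_ofPred_eq]
    constructor
    · exact fun hx => ⟨r, ⟨(x, r), hx, rfl⟩, x, hx, rfl⟩
    · rintro ⟨r', -, x', hx', heq⟩
      rwa [← heq]
  have : S.ncard ≤ (Prod.snd '' S).ncard * K := by
    conv_lhs => rw [hcover]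
    refine (Finset.set_ncard_biUnion_le _ _).trans ?_
    rw [Set.ncard_eq_toFinset_card (Prod.snd '' S), ← smul_eq_mul, ← Finset.sum_const]
    exact Finset.sum_le_sum fun r _ => (Set.ncard_image_le).trans (h₂ r).le
  have hK : 0 < K := by omega
  have := Nat.mul_lt_mul_of_pos_right h₁ hK
  omega

/-- From every row one can walk over half of the path without turning. -/
theorem exists_monotone_rows {K : ℕ} (hK : 2 * K ≤ k) (r : Fin k) :
    ∃ ρ : ℕ → Fin k, ρ 0 = r ∧ (∀ s, s + 1 < K → (pathGraph k).Adj (ρ s) (ρ (s + 1))) ∧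
      ∀ s t, s < t → t < K → ρ s ≠ ρ t := by
  have hr := r.2
  by_cases hlt : r.1 + K ≤ k
  -- The default `r` is never reached for `s < K`.
  · refine ⟨fun s => if hs : r.1 + s < k then ⟨r.1 + s, hs⟩ else r, by simp, fun s hs => ?_,
      fun s t hst ht => ?_⟩
    · rw [pathGraph_adj]
      simp only [dif_pos (show r.1 + s < k by omega), dif_pos (show r.1 + (s + 1) < k by omega)]
      exact Or.inl rfl
    · simp only [dif_pos (show r.1 + s < k by omega), dif_pos (show r.1 + t < k by omega), ne_eq,
        Fin.mk.injEq]
      omega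
  -- Here `r > k - K ≥ K`, so the subtraction does not truncate for `s < K`.
  · refine ⟨fun s => ⟨r.1 - s, by omega⟩, by simp, fun s hs => ?_, fun s t hst ht => ?_⟩
    · rw [pathGraph_adj]
      right
      simp only
      omega
    · simp only [ne_eq, Fin.mk.injEq]
      omega

/-- If the subtree of one child of `w` contains many vertices of `W` and the subtree of another
child contains a column of the big part, then the frontier has many vertices in the subtree of `w`
outside that of the third child. -/
theorem le_ncard_bigFrontier_diff {W : Set (TernaryNode h × Fin k)} {s : ℝ} {K : ℕ}
    (hK : 2 * K ≤ k) {w d : TernaryNode h} {a b c : Fin 3} (hab : a ≠ b) (hcb : c ≠ b)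
    (hac : a ≠ c) (hd : c :: w.1 <:+ d.1) (hdU : ∀ r, (d, r) ∈ (treePath h k).bigPart W s)
    (hW : K * K ≤ (W ∩ below h k (a :: w.1)).ncard) :
    K ≤ ((treePath h k).bigFrontier W s ∩ (below h k w.1 \ below h k (b :: w.1))).ncard := by
  have hwd : w.1 <:+ d.1 := (List.suffix_cons _ _).trans hd
  rcases exists_rows_or_row _ hW with hrows | ⟨r, hrow⟩
  -- With `K` distinct rows, each road stays in its own row, so the frontier vertices are distinct.
  · refine hrows.trans ?_
    have key : ∀ r ∈ Prod.snd '' (W ∩ below h k (a :: w.1)), ∃ u ∈ (treePath h k).bigFrontier W s ∩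
        (below h k w.1 \ below h k (b :: w.1)), u.2 = r := by
      rintro _ ⟨⟨x, r⟩, ⟨hxW, hx⟩, rfl⟩
      obtain ⟨u, hu, huF⟩ := exists_mem_road_bigFrontier (x := x)
        ((List.suffix_cons _ _).trans hx) hwd hdU (fun _ => r) 0 (by simp) hxW
      refine ⟨u, ⟨huF, road_subset hab hcb hx hd _ _ hu⟩, ?_⟩
      rcases hu with ⟨-, _, -, hu⟩ | ⟨-, hu⟩ <;> exact hu
    exact (Set.ncard_le_ncard (t := Prod.snd '' ((treePath h k).bigFrontier W s ∩
      (below h k w.1 \ below h k (b :: w.1)))) fun r hr => key r hr).trans Set.ncard_image_le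
  -- With `K` points in one row, sort them by depth and let the `i`-th walk `i` steps along its
  -- column before turning into the tree.
  · obtain ⟨ρ, rfl, hadj, hne⟩ := exists_monotone_rows hK r
    set X := {x : TernaryNode h | (x, ρ 0) ∈ W ∩ below h k (a :: w.1)} with hX
    let e : Fin X.ncard ≃ X := (Finite.equivFinOfCardEq (Nat.card_coe_set_eq X)).symm
    let f : Fin X.ncard → ℕ := fun i => (e i).1.1.length
    let y : Fin K → TernaryNode h := fun i => (e (Tuple.sort f (Fin.castLE hrow i))).1
    have hy : ∀ i, (y i, ρ 0) ∈ W ∩ below h k (a :: w.1) := fun i => (e _).2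
    have hyinj : Function.Injective y := fun i j hij =>
      Fin.castLE_injective hrow ((Tuple.sort f).injective (e.injective (Subtype.ext hij)))
    have hylen : ∀ i j, i ≤ j → (y i).1.length ≤ (y j).1.length := fun i j hij =>
      Tuple.monotone_sort f ((Fin.castLE_le_castLE_iff hrow).2 hij)
    have key : ∀ i : Fin K, ∃ u ∈ road w (y i) d ρ i, u ∈ (treePath h k).bigFrontier W s :=
      fun i => exists_mem_road_bigFrontier ((List.suffix_cons _ _).trans (hy i).2) hwd hdU ρ i
        (fun s hs => hadj s (by omega)) (hy i).1
    choose g hg hgF using key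
    have hlt : ∀ i j, i < j → g i ≠ g j := fun i j hij heq =>
      Set.disjoint_left.1 (road_disjoint hac (hy j).2 hd (fun h' => hij.ne (hyinj h'))
        (hylen i j hij.le) (fun t ht => hne t j (by omega) j.2)) (hg i) (heq ▸ hg j)
    refine le_ncard_of_injective g (fun i j hij => ?_) fun i =>
      ⟨hgF i, road_subset hab hcb (hy i).2 hd _ _ (hg i)⟩
    rcases lt_trichotomy i j with h' | h' | h'
    · exact absurd hij (hlt i j h')
    · exact h'
    · exact absurd hij.symm (hlt j i h')

/-! ### Induction on the height -/

/-- Three times can be ordered by a permutation of their indices. -/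
theorem exists_sorted_three (t : Fin 3 → ℕ) :
    ∃ a b c : Fin 3, a ≠ b ∧ c ≠ b ∧ a ≠ c ∧ t a ≤ t b ∧ t b ≤ t c := by
  have hinj := (Tuple.sort t).injective
  refine ⟨Tuple.sort t 0, Tuple.sort t 1, Tuple.sort t 2, hinj.ne (by decide), hinj.ne (by decide),
    hinj.ne (by decide), Tuple.monotone_sort t (by decide), Tuple.monotone_sort t (by decide)⟩

/-- A prefix at which a growing set of list members first reaches a given size. -/
theorem exists_take_ncard_eq {V : Type*} [Finite V] (π : List V) (hπ : ∀ v, v ∈ π) (S : Set V)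
    {m : ℕ} (hm : m ≤ S.ncard) : ∃ t, ({v | v ∈ π.take t} ∩ S).ncard = m := by
  have hex : ∃ t, m ≤ ({v | v ∈ π.take t} ∩ S).ncard := by
    refine ⟨π.length, ?_⟩
    rwa [List.take_length, show {v | v ∈ π} = Set.univ from Set.eq_univ_of_forall hπ,
      Set.univ_inter]
  classical
  refine ⟨Nat.find hex, le_antisymm ?_ (Nat.find_spec hex)⟩
  rcases ht : Nat.find hex with _ | t
  · simp
  · have hlt := Nat.find_min hex (m := t) (by omega)
    by_cases htl : t < π.length
    · have hsub : {v | v ∈ π.take (t + 1)} ∩ S ⊆ insert π[t] ({v | v ∈ π.take t} ∩ S) := by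
        rintro v ⟨hv, hvS⟩
        rw [Set.mem_ofPred_eq, List.take_succ_eq_append_getElem htl, List.mem_append,
          List.mem_singleton] at hv
        exact hv.elim (fun hv => Or.inr ⟨hv, hvS⟩) Or.inl
      have := (Set.ncard_le_ncard hsub).trans (Set.ncard_insert_le _ _)
      omega
    · rw [List.take_of_length_le (by omega)]
      rw [List.take_of_length_le (by omega)] at hlt
      omega

/-- The number of frontier vertices at a suitable time grows linearly with the height. -/
theorem exists_take_bigFrontier {s : ℝ} {K q H : ℕ} (hK : 2 * K ≤ k) (hk : 0 < k)
    (hq : K * K < 3 ^ q) (hs : s < ((3 ^ H * k : ℕ) : ℝ)) (π : List (TernaryNode h × Fin k))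
    (hπ : ∀ v, v ∈ π) (j : ℕ) (w : List (Fin 3)) (hw : w.length + (q + 1 + H) + j ≤ h) :
    ∃ t, K * K ≤ ({v | v ∈ π.take t} ∩ below h k w).ncard ∧
      (∃ e, w <:+ e ∧ e.length + 1 + H ≤ h ∧ ∀ v ∈ π.take t, v ∉ below h k e) ∧
      j * K ≤ ((treePath h k).bigFrontier {v | v ∈ π.take t} s ∩ below h k w).ncard := by
  induction j generalizing w with
  | zero =>
    have hm : K * K ≤ (below h k w).ncard :=
      (hq.le.trans (Nat.le_mul_of_pos_right _ hk)).trans (pow_mul_le_ncard_below (by omega))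
    obtain ⟨t, ht⟩ := exists_take_ncard_eq π hπ _ hm
    obtain ⟨e, hwe, hlen, he⟩ := exists_below_disjoint (ht.trans_lt hq)
    exact ⟨t, ht.ge, ⟨e, hwe, by omega, he⟩, by simp⟩
  | succ j ih =>
    have key := fun i : Fin 3 => ih (i :: w) (by simp; omega)
    choose t hm he hF using key
    -- The chosen time is the median `t b`; `a` supplies visited vertices and `c` the unvisited
    -- subtree.
    obtain ⟨a, b, c, hab, hcb, hac, htab, htbc⟩ := exists_sorted_three t
    have hmono : ∀ {t₁ t₂}, t₁ ≤ t₂ → ∀ v, v ∈ π.take t₁ → v ∈ π.take t₂ := fun hle _ hv =>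
      (List.take_sublist_take_left hle).subset hv
    refine ⟨t b, (hm b).trans (Set.ncard_le_ncard (Set.inter_subset_inter_right _
      (below_subset (List.suffix_cons _ _)))), ?_, ?_⟩
    · obtain ⟨e, hbe, hlen, he⟩ := he b
      exact ⟨e, (List.suffix_cons _ _).trans hbe, hlen, he⟩
    · obtain ⟨e, hce, hlen, he⟩ := he c
      have hnew : K ≤ ((treePath h k).bigFrontier {v | v ∈ π.take (t b)} s ∩
          (below h k w \ below h k (b :: w))).ncard :=
        le_ncard_bigFrontier_diff hK (w := ⟨w, by omega⟩) (d := ⟨0 :: e, by simp; omega⟩)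
          hab hcb hac (hce.trans (List.suffix_cons _ _))
          (fun r => mem_bigPart_of_below_disjoint hlen (fun v hv => he v (hmono htbc v hv)) hs _
            (List.suffix_refl _))
          ((hm a).trans (Set.ncard_le_ncard (Set.inter_subset_inter_left _ (hmono htab))))
      have hdisj : Disjoint
          ((treePath h k).bigFrontier {v | v ∈ π.take (t b)} s ∩ below h k (b :: w))
          ((treePath h k).bigFrontier {v | v ∈ π.take (t b)} s ∩
            (below h k w \ below h k (b :: w))) :=
        Set.disjoint_left.2 fun v hv hv' => hv'.2.2 hv.2
      calc (j + 1) * K = j * K + K := by ring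
        _ ≤ _ := Nat.add_le_add (hF b) hnew
        _ = _ := (Set.ncard_union_eq hdisj).symm
        _ ≤ _ := Set.ncard_le_ncard (Set.union_subset
          (Set.inter_subset_inter_right _ (below_subset (List.suffix_cons _ _)))
          (Set.inter_subset_inter_right _ Set.sdiff_subset))

theorem sqrt_le_four_mul_half (hk : 2 ≤ k) : Real.sqrt k ≤ 4 * ((k / 2 : ℕ) : ℝ) := by
  have h₁ : (k : ℝ) ≤ 4 * ((k / 2 : ℕ) : ℝ) := by
    have : k ≤ 4 * (k / 2) := by omega
    exact_mod_cast this
  refine le_trans ?_ h₁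
  have hk1 : (1 : ℝ) ≤ k := by exact_mod_cast (by omega : 1 ≤ k)
  rw [Real.sqrt_le_left (by positivity)]
  nlinarith

end TernaryPath

open TernaryPath in
theorem mainTheorem3 :
    ∃ c : ℝ, 0 < c ∧ ∃ k₀ : ℕ, ∀ α : ℝ, 0 < α → α < 1 → ∀ k : ℕ, k₀ ≤ k →
      ∃ h₀ : ℕ, ∀ h : ℕ, h₀ ≤ h →
        ∀ π : List (TernaryNode h × Fin k), IsPermutationOfVertices π →
          ∃ π₀ : List (TernaryNode h × Fin k), π₀ <+: π ∧
            ∃ U₀ U₁ : Set (TernaryNode h × Fin k),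
              IsTargetTriple (treePath h k) α {v | v ∈ π₀} U₀ U₁ ∧
                c * (1 - α) * (h : ℝ) * Real.sqrt (k : ℝ) ≤ (U₀.ncard : ℝ) := by
  -- 2744 = 7³ · 2 · 4: the loss from thinning, from `j ≥ (1 - α) h / 2`, and from `√k ≤ 4 K`.
  refine ⟨1 / 2744, by norm_num, 2, fun α hα hα' k hk => ?_⟩
  set K := k / 2 with hKdef
  set q := K * K with hqdef
  -- Since `j = h - q - 1 - H > (1 - α) h - (q + 3)`, this height makes `j` at least half of `(1 -
  -- α) h`.
  refine ⟨⌈2 * ((q : ℝ) + 3) / (1 - α)⌉₊, fun h hh π hπ => ?_⟩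
  have hpos : 0 < 1 - α := by linarith
  have hh' : 2 * ((q : ℝ) + 3) ≤ (1 - α) * h := by
    have := Nat.ceil_le.1 hh
    rw [div_le_iff₀ hpos] at this
    linarith
  set H := ⌈α * (h + 1)⌉₊ with hH
  have hHle : α * ((h : ℝ) + 1) ≤ H := Nat.le_ceil _
  have hHlt : (H : ℝ) < α * (h + 1) + 1 := Nat.ceil_lt_add_one (by positivity)
  have hb : q + 1 + H ≤ h := by
    have : (q : ℝ) + 1 + H ≤ h := by nlinarith
    exact_mod_cast this
  obtain ⟨j, hj⟩ := Nat.exists_eq_add_of_le hb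
  obtain ⟨t, -, -, ht⟩ := exists_take_bigFrontier (K := K) (q := q) (H := H) (by omega) (by omega)
    (Nat.lt_pow_self (by norm_num)) (card_rpow_lt hα hα' (by omega) hHle) π hπ.2 j [] (by simp; omega)
  obtain ⟨U₀, U₁, hU, hcard⟩ := SimpleGraph.exists_isTargetTriple ncard_closedNbhd_le
    treePath_triangle_free α {v | v ∈ π.take t}
  refine ⟨π.take t, List.take_prefix _ _, U₀, U₁, hU, ?_⟩
  have hjK : j * K ≤ 343 * U₀.ncard :=
    (ht.trans (Set.ncard_le_ncard Set.inter_subset_left)).trans hcard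
  have hjK' : (j : ℝ) * K ≤ 343 * U₀.ncard := by exact_mod_cast hjK
  have hj' : (h : ℝ) = q + 1 + H + j := by exact_mod_cast hj
  have hjge : (1 - α) * h ≤ 2 * j := by nlinarith
  have hmul : (1 - α) * h * Real.sqrt k ≤ 2 * j * (4 * K) :=
    mul_le_mul hjge (sqrt_le_four_mul_half hk) (Real.sqrt_nonneg _) (by positivity)
  linarith
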